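/- Let $\mathbb{T}^\infty=\mathbb{T}\times\mathbb{T}\times\cdots$ be the countably infinite torus with its normalized Haar measure $m_\infty$ (the product of the normalized arc length measures), and for a finitely supported integer sequence $\kappa=(\kappa_1,\kappa_2,\ldots)\in\mathbb{Z}^{(\infty)}$ let $\chi^\kappa=\prod_j\chi_j^{\kappa_j}$. For $f\in L^1(\mathbb{T}^\infty)$ let $$\widehat f(\kappa)=\int_{\mathbb{T}^\infty} f(\chi)\,\overline{\chi^\kappa}\,dm_\infty(\chi).$$ Let $H^1(\mathbb{T}^\infty)$ be the subspace of those $f\in L^1(\mathbb{T}^\infty)$ with $\widehat f(\kappa)=0$ whenever $\kappa_j<0$ for some $j$. For $d=1,2,3,\ldots$ and $f\in L^1(\mathbb{T}^\infty)$, the Abschnitt $\mathfrak{A}_d f$ is the unique element of $L^1(\mathbb{T}^\infty)$ whose Fourier coefficient at $\kappa$ is $\widehat f(\kappa)$ if $\kappa$ is of the form $(\kappa_1,\ldots,\kappa_d,0,0,\ldots)$, and $0$ otherwise. **Theorem (Hilbert's criterion for $H^1(\mathbb{T}^\infty)$).** (i) If $f$ is in $H^1(\mathbb{T}^\infty)$,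 then $\|f-\mathfrak{A}_d f\|_1\to 0$ as $d\to\infty$. (ii) If $(f_d)_{d\ge 1}$ is a sequence in $H^1(\mathbb{T}^\infty)$ that is bounded in the norm of $L^1(\mathbb{T}^\infty)$ and has the chain property $\mathfrak{A}_d f_{d+1}=f_d$ for $d=1,2,3,\ldots$, then there is a function $f$ in $H^1(\mathbb{T}^\infty)$ such that $f_d=\mathfrak{A}_d f$ for $d=1,2,3,\ldots$. -/

import Mathlib

open MeasureTheory Filter Topology

noncomputable section

/-- The unit circle carries its Borel σ-algebra. -/
instance Circle.instMeasurableSpaceBorel : MeasurableSpace Circle := borel Circle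

instance Circle.instBorelSpace : BorelSpace Circle := ⟨rfl⟩

namespace InfTorus

/-- Normalized arc length on the circle, i.e. its Haar probability measure. -/
def arc : Measure Circle := Measure.haarMeasure (⊤ : TopologicalSpace.PositiveCompacts Circle)

instance : IsProbabilityMeasure arc := ⟨Measure.haarMeasure_self⟩

instance : arc.IsMulLeftInvariant := by unfold arc; infer_instance

/-- The countably infinite torus; the coordinates `χ₁, χ₂, …` are `χ 0, χ 1, …`. -/
abbrev Torus : Type := ℕ → Circle

/-- The normalized Haar measure of the infinite torus: the product of the normalized arc
length measures. -/
def m : Measure Torus := Measure.infinitePi fun _ => arc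

instance : IsProbabilityMeasure m := by unfold m; infer_instance

/-- The character `χ ↦ χ^κ = ∏ⱼ χⱼ^{κⱼ}` for a finitely supported integer sequence `κ`. -/
def circleChar (κ : ℕ →₀ ℤ) (χ : Torus) : Circle := κ.prod fun j n => χ j ^ n

/-- The character `χ^κ` as a complex-valued function. -/
def char (κ : ℕ →₀ ℤ) (χ : Torus) : ℂ := (circleChar κ χ : ℂ)

/-- The space `L¹` of the infinite torus. -/
abbrev L1 : Type := Lp ℂ 1 m

/-- The Fourier coefficient `∫ f(χ) conj(χ^κ) dm(χ)`. -/
def coeff (f : Torus → ℂ) (κ : ℕ →₀ ℤ) : ℂ := ∫ χ, f χ * star (char κ χ) ∂m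

/-- `κ` has the form `(κ₁, …, κ_d, 0, 0, …)`. -/
def SuppBelow (d : ℕ) (κ : ℕ →₀ ℤ) : Prop := ∀ j, d ≤ j → κ j = 0

/-! ### Characters and coefficients -/

lemma continuous_char (κ : ℕ →₀ ℤ) : Continuous (char κ) := by
  have h : Continuous (circleChar κ) :=
    continuous_finsetProd _ fun j _ => (continuous_apply j).zpow _
  exact continuous_subtype_val.comp h

lemma norm_char (κ : ℕ →₀ ℤ) (χ : Torus) : ‖char κ χ‖ = 1 := Circle.norm_coe _

lemma char_zero (χ : Torus) : char 0 χ = 1 := by simp [char, circleChar]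

lemma char_add (κ l : ℕ →₀ ℤ) (χ : Torus) : char (κ + l) χ = char κ χ * char l χ := by
  have h : circleChar (κ + l) χ = circleChar κ χ * circleChar l χ :=
    Finsupp.prod_add_index' (by simp) (fun j a b => zpow_add _ _ _)
  rw [char, h, Circle.coe_mul, char, char]

lemma char_neg (κ : ℕ →₀ ℤ) (χ : Torus) : char (-κ) χ = star (char κ χ) := by
  have h : char (-κ) χ * char κ χ = 1 := by rw [← char_add, neg_add_cancel, char_zero]
  have h2 : star (char κ χ) * char κ χ = 1 := by
    have := Complex.conj_mul' (char κ χ)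
    rw [norm_char] at this
    simpa using this
  have h0 : char κ χ ≠ 0 := Circle.coe_ne_zero _
  exact mul_right_cancel₀ h0 (h.trans h2.symm)

lemma char_mul (κ : ℕ →₀ ℤ) (s χ : Torus) : char κ (s * χ) = char κ s * char κ χ := by
  have h : circleChar κ (s * χ) = circleChar κ s * circleChar κ χ := by
    simp [circleChar, Finsupp.prod, mul_zpow, Finset.prod_mul_distrib]
  rw [char, h, Circle.coe_mul, char, char]

lemma char_congr {κ : ℕ →₀ ℤ} {χ η : Torus} (h : ∀ j, κ j ≠ 0 → χ j = η j) :
    char κ χ = char κ η := by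
  have h : circleChar κ χ = circleChar κ η :=
    Finset.prod_congr rfl fun j hj => by simp only [h j (Finsupp.mem_support_iff.1 hj)]
  rw [char, h, char]

lemma integrable_mul_char {f : Torus → ℂ} (hf : Integrable f m) (κ : ℕ →₀ ℤ) :
    Integrable (fun χ => f χ * star (char κ χ)) m :=
  hf.mul_bdd (c := 1) (continuous_char κ).star.aestronglyMeasurable
    (Eventually.of_forall fun χ => by rw [norm_star, norm_char])

lemma coeff_congr {f g : Torus → ℂ} (h : f =ᵐ[m] g) (κ : ℕ →₀ ℤ) : coeff f κ = coeff g κ :=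
  integral_congr_ae (h.mono fun χ hχ => by simp only [hχ])

lemma coeff_sub {f g : Torus → ℂ} (hf : Integrable f m) (hg : Integrable g m) (κ : ℕ →₀ ℤ) :
    coeff (f - g) κ = coeff f κ - coeff g κ := by
  unfold coeff
  rw [← integral_sub (integrable_mul_char hf κ) (integrable_mul_char hg κ)]
  exact integral_congr_ae (Eventually.of_forall fun χ => by simp [sub_mul])

lemma coeff_add {f g : Torus → ℂ} (hf : Integrable f m) (hg : Integrable g m) (κ : ℕ →₀ ℤ) :
    coeff (f + g) κ = coeff f κ + coeff g κ := by
  unfold coeff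
  rw [← integral_add (integrable_mul_char hf κ) (integrable_mul_char hg κ)]
  exact integral_congr_ae (Eventually.of_forall fun χ => by simp [add_mul])

lemma integrable_L1 (f : L1) : Integrable f m := L1.integrable_coeFn f

/-! ### An integrable function is determined by its Fourier coefficients -/

/-- The trigonometric polynomials, as a star subalgebra of the continuous functions. -/
def trigPoly : StarSubalgebra ℂ C(Torus, ℂ) where
  carrier := Submodule.span ℂ
    (Set.range fun κ => (⟨char κ, continuous_char κ⟩ : C(Torus, ℂ)))
  mul_mem' := by
    intro a b ha hb
    have h := Submodule.mul_mem_mul ha hb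
    rw [Submodule.span_mul_span] at h
    refine Submodule.span_mono ?_ h
    rintro _ ⟨_, ⟨κ, rfl⟩, _, ⟨l, rfl⟩, rfl⟩
    exact ⟨κ + l, by ext χ; simp [char_add]⟩
  add_mem' := fun ha hb => Submodule.add_mem _ ha hb
  algebraMap_mem' := by
    intro r
    have : algebraMap ℂ C(Torus, ℂ) r = r • (⟨char 0, continuous_char 0⟩ : C(Torus, ℂ)) := by
      ext χ; simp [char_zero]
    rw [this]
    exact Submodule.smul_mem _ _ (Submodule.subset_span ⟨0, rfl⟩)
  star_mem' := by
    intro a ha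
    refine Submodule.span_induction (p := fun a _ => star a ∈ Submodule.span ℂ
      (Set.range fun κ => (⟨char κ, continuous_char κ⟩ : C(Torus, ℂ)))) ?_ ?_ ?_ ?_ ha
    · rintro _ ⟨κ, rfl⟩
      exact Submodule.subset_span ⟨-κ, by ext χ; simp [char_neg]⟩
    · simp
    · intro x y _ _ hx hy
      rw [star_add]; exact Submodule.add_mem _ hx hy
    · intro r x _ hx
      rw [star_smul]; exact Submodule.smul_mem _ _ hx

lemma trigPoly_dense : trigPoly.topologicalClosure = ⊤ := by
  apply ContinuousMap.starSubalgebra_topologicalClosure_eq_top_of_separatesPoints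
  intro χ η h
  obtain ⟨j, hj⟩ := Function.ne_iff.1 h
  refine ⟨_, ⟨⟨char (Finsupp.single j 1), continuous_char _⟩,
    Submodule.subset_span ⟨_, rfl⟩, rfl⟩, ?_⟩
  have h1 : ∀ ψ : Torus, char (Finsupp.single j 1) ψ = ψ j := fun ψ => by
    simp [char, circleChar]
  change char (Finsupp.single j 1) χ ≠ char (Finsupp.single j 1) η
  rw [h1, h1]
  exact fun h => hj (Circle.ext h)

lemma integral_mul_continuous_eq_zero {f : Torus → ℂ} (hf : Integrable f m)
    (h : ∀ κ, coeff f κ = 0) (g : C(Torus, ℂ)) : ∫ χ, f χ * g χ ∂m = 0 := by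
  have hint : ∀ g : C(Torus, ℂ), Integrable (fun χ => f χ * g χ) m := fun g =>
    hf.mul_bdd (c := ‖g‖) g.continuous.aestronglyMeasurable
      (Eventually.of_forall fun χ => g.norm_coe_le_norm χ)
  let Λ : C(Torus, ℂ) →ₗ[ℂ] ℂ :=
    { toFun := fun g => ∫ χ, f χ * g χ ∂m
      map_add' := fun a b => by
        rw [← integral_add (hint a) (hint b)]
        simp [mul_add]
      map_smul' := fun r a => by
        simp only [ContinuousMap.smul_apply, smul_eq_mul, RingHom.id_apply]
        rw [← integral_const_mul]
        congr 1; ext χ; ring }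
  let Λc : C(Torus, ℂ) →L[ℂ] ℂ := Λ.mkContinuous (∫ χ, ‖f χ‖ ∂m) fun g => by
    rw [← integral_mul_const]
    refine norm_integral_le_of_norm_le (hf.norm.mul_const _) (Eventually.of_forall fun χ => ?_)
    rw [norm_mul]
    exact mul_le_mul_of_nonneg_left (g.norm_coe_le_norm χ) (norm_nonneg _)
  have hsub : (trigPoly : Set C(Torus, ℂ)) ⊆ {g | Λc g = 0} := by
    intro g hg
    refine Submodule.span_induction (p := fun g _ => Λc g = 0) ?_ ?_ ?_ ?_ hg
    · rintro _ ⟨κ, rfl⟩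
      have := h (-κ)
      simp only [coeff, char_neg, star_star] at this
      exact this
    · simp
    · intro x y _ _ hx hy; rw [map_add, hx, hy, add_zero]
    · intro r x _ hx; rw [map_smul, hx, smul_zero]
  have hcl : IsClosed {g | Λc g = 0} := isClosed_eq Λc.continuous continuous_const
  have hmem : g ∈ trigPoly.topologicalClosure := by rw [trigPoly_dense]; trivial
  exact closure_minimal hsub hcl hmem

lemma ae_eq_zero_of_coeff {f : Torus → ℂ} (hf : Integrable f m)
    (h : ∀ κ, coeff f κ = 0) : f =ᵐ[m] 0 := by
  refine hf.ae_eq_zero_of_forall_setIntegral_eq_zero fun s hs _ => ?_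
  have hfin : IsFiniteMeasure (m.withDensity fun χ => ‖f χ‖ₑ) :=
    isFiniteMeasure_withDensity hf.2.ne
  rw [← norm_le_zero_iff]
  refine le_of_forall_pos_le_add fun ε hε => ?_
  have hmem : MemLp (s.indicator fun _ => (1 : ℂ)) 1 (m.withDensity fun χ => ‖f χ‖ₑ) :=
    memLp_indicator_const 1 hs 1 (Or.inr (measure_ne_top _ _))
  obtain ⟨g, hg, -⟩ := hmem.exists_boundedContinuous_eLpNorm_sub_le (by simp)
    (ε := ENNReal.ofReal ε) (by simpa using hε)
  have hg0 : ∫ χ, f χ * g χ ∂m = 0 := integral_mul_continuous_eq_zero hf h g.toContinuousMap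
  have hgint : Integrable (fun χ => f χ * g χ) m :=
    hf.mul_bdd (c := ‖g‖) g.continuous.aestronglyMeasurable
      (Eventually.of_forall fun χ => g.norm_coe_le_norm χ)
  have h1 : ∫ χ in s, f χ ∂m
      = ∫ χ, f χ * ((s.indicator fun _ => (1 : ℂ)) χ - g χ) ∂m := by
    simp_rw [mul_sub]
    have hi : (fun χ => f χ * (s.indicator fun _ => (1 : ℂ)) χ) = s.indicator f := by
      ext χ; by_cases hχ : χ ∈ s <;> simp [hχ]
    rw [integral_sub (by rw [hi]; exact hf.indicator hs) hgint, hg0, sub_zero, hi,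
      integral_indicator hs]
  rw [h1, zero_add]
  have h2 : ∫⁻ χ, ‖f χ * ((s.indicator fun _ => (1 : ℂ)) χ - g χ)‖ₑ ∂m ≤ ENNReal.ofReal ε := by
    rw [eLpNorm_one_eq_lintegral_enorm, lintegral_withDensity_eq_lintegral_mul₀
      hf.1.enorm] at hg
    · simpa [enorm_mul] using hg
    · exact ((measurable_const.indicator hs).sub g.continuous.measurable).enorm.aemeasurable
  have h3 := (enorm_integral_le_lintegral_enorm _).trans h2
  rwa [← ofReal_norm, ENNReal.ofReal_le_ofReal_iff hε.le] at h3

/-! ### Existence and uniqueness of the Abschnitt -/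

/-- The point with the first `d` coordinates of `χ` and the remaining coordinates of `η`. -/
def glue (d : ℕ) (p : Torus × Torus) : Torus := fun j => if j < d then p.1 j else p.2 j

lemma measurePreserving_glue (d : ℕ) : MeasurePreserving (glue d) (m.prod m) m := by
  have hmeas : Measurable (glue d) := by
    refine measurable_pi_lambda _ fun j => ?_
    have hev : Measurable fun χ : Torus => χ j := measurable_pi_apply j
    by_cases hj : j < d
    · simp only [glue, hj, if_true]
      exact hev.comp measurable_fst
    · simp only [glue, hj, if_false]
      exact hev.comp measurable_snd
  refine ⟨hmeas, Measure.eq_infinitePi _ fun s t ht => ?_⟩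
  rw [Measure.map_apply hmeas (MeasurableSet.pi s.countable_toSet fun i _ => ht i)]
  have : glue d ⁻¹' ((s : Set ℕ).pi t)
      = ((s.filter (· < d) : Finset ℕ) : Set ℕ).pi t ×ˢ
        ((s.filter (¬ · < d) : Finset ℕ) : Set ℕ).pi t := by
    ext ⟨χ, η⟩
    simp only [glue, Set.mem_preimage, Set.mem_pi, Set.mem_prod, Finset.coe_filter,
      Set.mem_ofPred_eq, Finset.mem_coe]
    constructor
    · intro h
      exact ⟨fun i hi => by simpa [hi.2] using h i hi.1,
        fun i hi => by simpa [hi.2] using h i hi.1⟩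
    · rintro ⟨h1, h2⟩ i hi
      by_cases hd : i < d
      · simpa [hd] using h1 i ⟨hi, hd⟩
      · simpa [hd] using h2 i ⟨hi, hd⟩
  rw [this, Measure.prod_prod, m, Measure.infinitePi_pi _ fun i _ => ht i,
    Measure.infinitePi_pi _ fun i _ => ht i, Finset.prod_filter_mul_prod_filter_not]

lemma measurePreserving_mul (s : Torus) : MeasurePreserving (fun χ => s * χ) m m := by
  refine ⟨measurable_pi_lambda _ fun j =>
    (measurable_const_mul (s j)).comp (measurable_pi_apply (X := fun _ : ℕ => Circle) j), ?_⟩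
  have := Measure.infinitePi_map_pi (fun _ : ℕ => arc) (f := fun j z => s j * z)
    fun j => measurable_const_mul (s j)
  simp only [map_mul_left_eq_self] at this
  exact this

lemma coeff_average {f : Torus → ℂ} (hf : Integrable f m) (d : ℕ) (κ : ℕ →₀ ℤ)
    [Decidable (SuppBelow d κ)] :
    coeff (fun χ => ∫ η, f (glue d (χ, η)) ∂m) κ = if SuppBelow d κ then coeff f κ else 0 := by
  split_ifs with hκ
  · have h1 := (measurePreserving_glue d).integrable_comp_of_integrable
      (integrable_mul_char hf κ)
    have h2 : coeff f κ = ∫ p, f (glue d p) * star (char κ (glue d p)) ∂(m.prod m) := by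
      have hg := measurePreserving_glue d
      have := integral_map (μ := m.prod m) hg.measurable.aemeasurable
        (f := fun χ => f χ * star (char κ χ))
        (by rw [hg.map_eq]; exact (integrable_mul_char hf κ).1)
      rw [hg.map_eq] at this
      exact this
    have h3 := integral_prod _ h1
    simp only [Function.comp_def] at h3
    rw [h2, h3]
    unfold coeff
    congr 1
    ext χ
    rw [← integral_mul_const]
    congr 1
    ext η
    congr 2
    refine char_congr fun j hj => ?_
    have : j < d := by
      by_contra hd
      exact hj (hκ j (not_lt.1 hd))
    simp [glue, this]
  · unfold SuppBelow at hκ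
    push Not at hκ
    obtain ⟨j, hj, hne⟩ := hκ
    set F : Torus → ℂ := fun χ => ∫ η, f (glue d (χ, η)) ∂m with hF
    have hFint : Integrable F m :=
      ((measurePreserving_glue d).integrable_comp_of_integrable hf).integral_prod_left
    let s : Torus := Pi.mulSingle j (Circle.exp (Real.pi / κ j))
    have hs : char κ s = -1 := by
      have : κ.prod (fun i n => s i ^ n) = s j ^ κ j := by
        refine Finsupp.prod_eq_single j (fun i _ hij => ?_) (by simp)
        simp [s, Pi.mulSingle_eq_of_ne hij]
      have hne' : (κ j : ℝ) ≠ 0 := by exact_mod_cast hne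
      rw [char, circleChar, this]
      simp only [s, Pi.mulSingle_eq_same]
      rw [← Circle.exp_zsmul, zsmul_eq_mul, mul_div_cancel₀ _ hne']
      simp
    have hglue : ∀ χ, F (s * χ) = F χ := by
      intro χ
      simp only [hF]
      congr 1; ext η; congr 1
      ext i
      by_cases hi : i < d
      · have : i ≠ j := by omega
        simp [glue, hi, s, Pi.mulSingle_eq_of_ne this]
      · simp [glue, hi]
    have key : coeff F κ = -coeff F κ := by
      have hg := measurePreserving_mul s
      have := integral_map (μ := m) hg.measurable.aemeasurable
        (f := fun χ => F χ * star (char κ χ))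
        (by rw [hg.map_eq]; exact (integrable_mul_char hFint κ).1)
      rw [hg.map_eq] at this
      refine this.trans ?_
      unfold coeff
      rw [← integral_neg]
      congr 1; ext χ
      rw [hglue, char_mul, hs]
      simp
    linear_combination key / 2

/-- Replacing by zero the Fourier coefficients of `f ∈ L¹` at all `κ` that are not of the form
`(κ₁, …, κ_d, 0, 0, …)` gives the Fourier coefficients of exactly one element of `L¹`. -/
theorem existsUnique_abschnitt (d : ℕ) (f : L1) :
    ∃! g : L1, (∀ κ, SuppBelow d κ → coeff g κ = coeff f κ) ∧
      ∀ κ, ¬ SuppBelow d κ → coeff g κ = 0 := by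
  classical
  have hf := integrable_L1 f
  have hF : Integrable (fun χ => ∫ η, f (glue d (χ, η)) ∂m) m :=
    ((measurePreserving_glue d).integrable_comp_of_integrable hf).integral_prod_left
  refine ⟨hF.toL1 _, ⟨fun κ hκ => ?_, fun κ hκ => ?_⟩, ?_⟩
  · rw [coeff_congr hF.coeFn_toL1, coeff_average hf, if_pos hκ]
  · rw [coeff_congr hF.coeFn_toL1, coeff_average hf, if_neg hκ]
  · rintro g ⟨hg1, hg2⟩
    have h0 := ae_eq_zero_of_coeff ((integrable_L1 g).sub hF) fun κ => by
      rw [coeff_sub (integrable_L1 g) hF, coeff_average hf]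
      split_ifs with hκ
      · rw [hg1 κ hκ, sub_self]
      · rw [hg2 κ hκ, sub_self]
    refine Lp.ext ?_
    filter_upwards [h0, hF.coeFn_toL1] with χ h1 h2
    rw [h2]
    exact sub_eq_zero.1 h1

/-- The Abschnitt `𝔄_d f`: the element of `L¹` whose Fourier coefficients are those of `f` at
the `κ` of the form `(κ₁, …, κ_d, 0, 0, …)` and zero at all other `κ`. -/
def abschnitt (d : ℕ) (f : L1) : L1 := (existsUnique_abschnitt d f).choose

theorem abschnitt_spec (d : ℕ) (f : L1) :
    (∀ κ, SuppBelow d κ → coeff (abschnitt d f) κ = coeff f κ) ∧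
      ∀ κ, ¬ SuppBelow d κ → coeff (abschnitt d f) κ = 0 :=
  (existsUnique_abschnitt d f).choose_spec.1

/-- The Hardy space `H¹` of the infinite torus: the functions in `L¹` whose Fourier coefficients
are supported on the sequences of nonnegative integers. -/
def H1 : Submodule ℂ L1 where
  carrier := {f | ∀ κ : ℕ →₀ ℤ, (¬ ∀ j, 0 ≤ κ j) → coeff f κ = 0}
  zero_mem' := fun κ _ => by
    rw [coeff_congr (Lp.coeFn_zero ℂ 1 m)]; simp [coeff]
  add_mem' := fun {f g} hf hg κ hκ => by
    rw [coeff_congr (Lp.coeFn_add f g), coeff_add (integrable_L1 f) (integrable_L1 g),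
      hf κ hκ, hg κ hκ, add_zero]
  smul_mem' := fun c f hf κ hκ => by
    have h := hf κ hκ
    rw [coeff_congr (Lp.coeFn_smul c f)]
    unfold coeff at h ⊢
    simp only [Pi.smul_apply, smul_eq_mul, mul_assoc]
    rw [integral_const_mul, h, mul_zero]

end InfTorus

end

/-!
The Abschnitt `abschnitt d` averages over all coordinates beyond the first `d`, so it is a
contraction of `L¹` (`norm_abschnitt_le`). Every `f ∈ H¹` is an `L¹` limit of analytic
trigonometric polynomials (`H1_le_closure_analyticPoly`), and each of these is fixed by `abschnitt d`
as soon as `d` is large; both facts together give the convergence of the Abschnitte of `f`.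

For the converse, analyticity has to prevent the bounded martingale `f d` from converging to a
singular measure. This is done by the inequality

  `‖f - abschnitt d f‖ ≤ 3 ε ‖f‖ + (‖f‖ - ‖abschnitt d f‖) / ε`, for `f ∈ H¹` and `0 < ε ≤ 1`

(`norm_sub_abschnitt_le`). Along a chain the norms `‖f d‖` increase and are bounded, so the
inequality shows that `f d` is a Cauchy sequence in `L¹`. Its limit is in the closed subspace `H¹`
and, the Abschnitte being continuous, has the `f d` as its Abschnitte.

By density it suffices to prove the inequality for analytic trigonometric polynomials. Rotating all
coordinates beyond the first `d` by a common `z` turns such a polynomial, at each point of the torus,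
into a polynomial `p` in `z` whose value at `0` is the Abschnitt at that point. The inequality is
therefore the integral over the torus of its one-variable version for `p` and the constant `p 0`
(`circleAverage_norm_eval_sub_le`). There the mean of `‖p‖ - Re (p · conj (p 0)) / ‖p 0‖`, which is
the mean of `‖p‖` minus `‖p 0‖` by the mean value property, controls the argument of `p`; and the
mean of `(√‖p‖ - √‖p 0‖)²`, which is at most that same quantity because `√‖p‖` is
subharmonic (`sqrt_norm_eval_zero_le`), controls its modulus.
-/

noncomputable section

namespace InfTorus

/-! ### An estimate for polynomials on the unit circle -/

section

open Real

/-- Both terms of the sum divided by `2 * ε` are nonnegative. The first, the defect in the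
Cauchy–Schwarz inequality, controls the argument of `w` relative to that of `a`; the second
controls the modulus. -/
lemma norm_sub_le_add_div {ε : ℝ} (hε : 0 < ε) {a : ℂ} (ha : a ≠ 0) (w : ℂ) :
    ‖w - a‖ ≤ ε * (2 * ‖w‖ + ‖a‖) +
      (‖w‖ - ‖a‖⁻¹ * inner ℝ a w + (√‖w‖ - √‖a‖) ^ 2) / (2 * ε) := by
  have ha' : 0 < ‖a‖ := norm_pos_iff.2 ha
  -- `t • a` is the point on the ray through `a` with the modulus of `w`
  set t : ℝ := ‖w‖ / ‖a‖ with ht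
  set X : ℝ := ‖w‖ - ‖a‖⁻¹ * inner ℝ a w with hX
  have hta : ‖t • a‖ = ‖w‖ := by
    rw [norm_smul, Real.norm_of_nonneg (by positivity), ht]; field_simp
  have h1 : ‖w - t • a‖ ^ 2 = 2 * ‖w‖ * X := by
    rw [norm_sub_sq_real, hta, inner_smul_right, real_inner_comm, hX, ht]
    field_simp
    ring
  have hX0 : 0 ≤ X := by
    have := real_inner_le_norm a w
    rw [hX, sub_nonneg, inv_mul_le_iff₀ ha']
    exact this
  have h2 : ‖t • a - a‖ = |‖w‖ - ‖a‖| := by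
    rw [show t • a - a = (t - 1) • a by module, norm_smul, Real.norm_eq_abs]
    nth_rewrite 1 [← abs_of_pos ha']
    rw [← abs_mul, ht, sub_mul, one_mul, div_mul_cancel₀ _ ha'.ne']
  have h3 : ‖w - t • a‖ ≤ ε * ‖w‖ + X / (2 * ε) := by
    refine abs_le_of_sq_le_sq' ?_ (by positivity) |>.2
    rw [h1]
    have := sq_nonneg (ε * ‖w‖ - X / (2 * ε))
    have e : ε * ‖w‖ * (X / (2 * ε)) = ‖w‖ * X / 2 := by field_simp
    nlinarith
  have h4 : |‖w‖ - ‖a‖| ≤ ε * (‖w‖ + ‖a‖) + (√‖w‖ - √‖a‖) ^ 2 / (2 * ε) := by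
    have hw := Real.sq_sqrt (norm_nonneg w)
    have hA := Real.sq_sqrt (norm_nonneg a)
    set x := √‖w‖
    set y := √‖a‖
    rw [← hw, ← hA, show x ^ 2 - y ^ 2 = (x - y) * (x + y) by ring]
    refine abs_le_of_sq_le_sq ?_ (by positivity)
    have h5 : (x + y) ^ 2 ≤ 2 * (x ^ 2 + y ^ 2) := by nlinarith [sq_nonneg (x - y)]
    have h6 := sq_nonneg (ε * (x ^ 2 + y ^ 2) - (x - y) ^ 2 / (2 * ε))
    have e : ε * (x ^ 2 + y ^ 2) * ((x - y) ^ 2 / (2 * ε)) = (x ^ 2 + y ^ 2) * (x - y) ^ 2 / 2 := by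
      field_simp
    have h7 := mul_le_mul_of_nonneg_left h5 (sq_nonneg (x - y))
    nlinarith
  calc ‖w - a‖ ≤ ‖w - t • a‖ + ‖t • a - a‖ := norm_sub_le_norm_sub_add_norm_sub _ _ _
    _ ≤ (ε * ‖w‖ + X / (2 * ε)) + (ε * (‖w‖ + ‖a‖) + (√‖w‖ - √‖a‖) ^ 2 / (2 * ε)) := by
        rw [h2]; exact add_le_add h3 h4
    _ = _ := by ring

lemma norm_eval_zero_le_mahlerMeasure (p : Polynomial ℂ) : ‖p.eval 0‖ ≤ p.mahlerMeasure := by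
  rw [Polynomial.mahlerMeasure_eq_leadingCoeff_mul_prod_roots]
  have h := (IsAlgClosed.splits p).eval_eq_prod_roots 0
  rw [h, norm_mul]
  gcongr
  have : ‖(p.roots.map fun a => (0 : ℂ) - a).prod‖ = (p.roots.map fun a => ‖a‖).prod := by
    have := map_multiset_prod (normHom : ℂ →*₀ ℝ) (p.roots.map fun a => (0 : ℂ) - a)
    simpa [Multiset.map_map, Function.comp_def] using this
  rw [this]
  exact Multiset.prod_map_le_prod_map₀ _ _ (fun _ _ => norm_nonneg _) fun _ _ => le_max_right _ _

/-- The subharmonicity of `√‖p‖` at the origin. It follows from that of `log ‖p‖`, which is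
`norm_eval_zero_le_mahlerMeasure`, by Jensen's inequality for the exponential function, used in
the form of the tangent line bound at `log c`. -/
lemma sqrt_norm_eval_zero_le (p : Polynomial ℂ) :
    √‖p.eval 0‖ ≤ circleAverage (fun z => √‖p.eval z‖) 0 1 := by
  rcases eq_or_ne (p.eval 0) 0 with h0 | h0
  · rw [h0]
    simp
    exact circleAverage_nonneg_of_nonneg fun _ _ => Real.sqrt_nonneg _
  have hp : p ≠ 0 := by rintro rfl; simp at h0
  set c := √‖p.eval 0‖ with hc
  have hcpos : 0 < c := Real.sqrt_pos.2 (norm_pos_iff.2 h0)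
  have hlog : Real.log c ≤ (1 / 2) * circleAverage (fun z => Real.log ‖p.eval z‖) 0 1 := by
    rw [← Polynomial.logMahlerMeasure_def, Polynomial.logMahlerMeasure_eq_log_MahlerMeasure, hc,
      Real.log_sqrt (norm_nonneg _), div_eq_inv_mul, one_div]
    gcongr
    exact norm_eval_zero_le_mahlerMeasure p
  have hint : CircleIntegrable (fun z => Real.log ‖p.eval z‖) 0 1 :=
    p.intervalIntegrable_mahlerMeasure
  have hint2 : CircleIntegrable (fun z => √‖p.eval z‖) 0 1 :=
    ContinuousOn.circleIntegrable' (by fun_prop)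
  let h : ℂ → ℝ := fun z => (c - c * Real.log c) + (c / 2) * Real.log ‖p.eval z‖
  have hh : CircleIntegrable h 0 1 := (circleIntegrable_const _ _ _).add hint.const_fun_smul
  classical
  -- At the finitely many zeros of `p`, where `Real.log 0 = 0` breaks the tangent line bound, the
  -- square root is replaced by `h`.
  let k : ℂ → ℝ := fun z => if p.eval z = 0 then h z else √‖p.eval z‖
  have hk : (fun z => √‖p.eval z‖) =ᶠ[codiscreteWithin (Metric.sphere 0 |1|)] k := by
    have hfin : {z | p.eval z = 0}.Finite := by
      simpa [Polynomial.IsRoot] using p.finite_setOfPred_isRoot hp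
    filter_upwards [compl_finite_mem_codiscreteWithin hfin] with z hz
    simp only [k, if_neg (show ¬ p.eval z = 0 from hz)]
  have hle : ∀ z, h z ≤ k z := by
    intro z
    by_cases hz : p.eval z = 0
    · simp [k, hz]
    · have hx : 0 < √‖p.eval z‖ := Real.sqrt_pos.2 (norm_pos_iff.2 hz)
      have h1 := Real.log_le_sub_one_of_pos (div_pos hx hcpos)
      rw [Real.log_div hx.ne' hcpos.ne', Real.log_sqrt (norm_nonneg _)] at h1
      have h2 := mul_le_mul_of_nonneg_left h1 hcpos.le
      rw [mul_sub c _ 1, mul_div_cancel₀ _ hcpos.ne'] at h2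
      simp only [k, hz, if_false, h]
      linarith
  rw [circleAverage_congr_codiscreteWithin hk one_ne_zero]
  calc c ≤ (c - c * Real.log c) + (c / 2) * circleAverage (fun z => Real.log ‖p.eval z‖) 0 1 := by
        have := mul_le_mul_of_nonneg_left hlog hcpos.le
        linarith
    _ = circleAverage h 0 1 := by
        have h1 := circleAverage_fun_add (circleIntegrable_const (c - c * Real.log c) 0 1)
          (hint.const_fun_smul (a := c / 2))
        have h2 := circleAverage_fun_smul (a := c / 2) (f := fun z => Real.log ‖p.eval z‖)
          (c := 0) (R := 1)
        simp only [smul_eq_mul] at h1 h2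
        rw [h1, h2, circleAverage_const]
    _ ≤ _ := circleAverage_mono hh (hint2.congr_codiscreteWithin hk) fun z _ => hle z

/-- If the mean of `‖p‖` over the unit circle is close to `‖p 0‖`, then `p` is close to the constant
`p 0` in mean. Averaging the pointwise bound `norm_sub_le_add_div`, the mean value property takes
care of the inner product, and `sqrt_norm_eval_zero_le` of the square roots. -/
lemma circleAverage_norm_eval_sub_le (p : Polynomial ℂ) {ε : ℝ} (hε : 0 < ε) (hε1 : ε ≤ 1) :
    circleAverage (fun z => ‖p.eval z - p.eval 0‖) 0 1 ≤
      3 * ε * circleAverage (fun z => ‖p.eval z‖) 0 1 +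
        (circleAverage (fun z => ‖p.eval z‖) 0 1 - ‖p.eval 0‖) / ε := by
  have ci : ∀ {f : ℂ → ℝ}, Continuous f → CircleIntegrable f 0 1 := fun hf =>
    hf.continuousOn.circleIntegrable'
  set N := circleAverage (fun z => ‖p.eval z‖) 0 1 with hN
  have hN0 : 0 ≤ N := circleAverage_nonneg_of_nonneg fun _ _ => norm_nonneg _
  set a := p.eval 0 with ha
  rcases eq_or_ne a 0 with h0 | h0
  · simp only [h0, sub_zero, norm_zero, ← hN]
    have : N ≤ N / ε := le_div_self hN0 hε hε1
    have : 0 ≤ 3 * ε * N := by positivity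
    linarith
  have ha0 : 0 < ‖a‖ := norm_pos_iff.2 h0
  have hmean : circleAverage (fun z => p.eval z) 0 1 = a :=
    DiffContOnCl.circleAverage p.differentiable.diffContOnCl
  have hinner : circleAverage (fun z => inner ℝ a (p.eval z)) 0 1 = ‖a‖ ^ 2 := by
    have := (innerSL ℝ a).circleAverage_comp_comm (f := fun z => p.eval z) (c := 0) (R := 1)
      p.continuous.continuousOn.circleIntegrable'
    rw [hmean] at this
    simpa [Function.comp_def] using this
  have hsqrt := sqrt_norm_eval_zero_le p
  set S := circleAverage (fun z => √‖p.eval z‖) 0 1 with hS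
  have hSa : ‖a‖ ≤ √‖a‖ * S := by
    calc ‖a‖ = √‖a‖ * √‖a‖ := (Real.mul_self_sqrt (norm_nonneg _)).symm
      _ ≤ _ := by gcongr
  have key : circleAverage (fun z => ‖p.eval z - a‖) 0 1 ≤
      circleAverage (fun z => (2 * ε + 1 / ε) • ‖p.eval z‖ + ((-(‖a‖⁻¹ / (2 * ε))) •
        inner ℝ a (p.eval z) + ((-(√‖a‖ / ε)) • √‖p.eval z‖ + (ε * ‖a‖ + ‖a‖ / (2 * ε))))) 0 1 := by
    refine circleAverage_mono (ci (by fun_prop)) (ci (by fun_prop)) fun z _ => ?_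
    refine (norm_sub_le_add_div hε h0 (p.eval z)).trans_eq ?_
    rw [sub_sq, Real.sq_sqrt (norm_nonneg _), Real.sq_sqrt (norm_nonneg _)]
    simp only [smul_eq_mul]
    field_simp
    ring
  refine key.trans ?_
  rw [circleAverage_fun_add (ci (by fun_prop)) (ci (by fun_prop)),
    circleAverage_fun_add (ci (by fun_prop)) (ci (by fun_prop)),
    circleAverage_fun_add (ci (by fun_prop)) (ci (by fun_prop)), circleAverage_const,
    circleAverage_fun_smul, circleAverage_fun_smul, circleAverage_fun_smul, hinner, ← hS, ← hN]
  simp only [smul_eq_mul]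
  have haN : ‖a‖ ≤ N := by
    have h1 := circleAverage_mono (c := 0) (R := 1) (f₁ := fun z => inner ℝ a (p.eval z))
      (f₂ := fun z => ‖a‖ • ‖p.eval z‖) (ci (by fun_prop)) (ci (by fun_prop))
      fun z _ => real_inner_le_norm _ _
    rw [hinner, circleAverage_fun_smul, smul_eq_mul, sq] at h1
    exact le_of_mul_le_mul_left h1 ha0
  have e1 : √‖a‖ / ε * S ≥ ‖a‖ / ε := by
    rw [div_mul_eq_mul_div]; gcongr
  have e2 : ‖a‖⁻¹ / (2 * ε) * ‖a‖ ^ 2 = ‖a‖ / ε / 2 := by field_simp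
  have e3 : ε * ‖a‖ ≤ ε * N := by gcongr
  have e4 : ‖a‖ / (2 * ε) = ‖a‖ / ε / 2 := by field_simp
  have e5 : (N - ‖a‖) / ε = 1 / ε * N - ‖a‖ / ε := by ring
  rw [e5, e4]
  nlinarith
end

/-! ### Fourier coefficients as continuous functionals -/

lemma integrable_of_continuous {E : Type*} [NormedAddCommGroup E] {f : Torus → E}
    (hf : Continuous f) : Integrable f m :=
  hf.integrable_of_hasCompactSupport (.of_compactSpace f)

lemma L1_ext {f g : L1} (h : ∀ κ, coeff f κ = coeff g κ) : f = g := by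
  have h0 := ae_eq_zero_of_coeff ((integrable_L1 f).sub (integrable_L1 g)) fun κ => by
    rw [coeff_sub (integrable_L1 f) (integrable_L1 g), h, sub_self]
  exact Lp.ext (h0.mono fun χ hχ => sub_eq_zero.1 hχ)

lemma norm_coeff_le (f : L1) (κ : ℕ →₀ ℤ) : ‖coeff f κ‖ ≤ ‖f‖ := by
  rw [L1.norm_eq_integral_norm]
  refine norm_integral_le_of_norm_le (integrable_L1 f).norm (Eventually.of_forall fun χ => ?_)
  rw [norm_mul, norm_star, norm_char, mul_one]

/-- The Fourier coefficient at `κ` as a continuous linear functional on `L¹`. -/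
def coeffL (κ : ℕ →₀ ℤ) : L1 →L[ℂ] ℂ :=
  LinearMap.mkContinuous
    { toFun := fun f => coeff f κ
      map_add' := fun f g => by
        rw [coeff_congr (Lp.coeFn_add f g), coeff_add (integrable_L1 f) (integrable_L1 g)]
      map_smul' := fun c f => by
        rw [coeff_congr (Lp.coeFn_smul c f)]
        simp only [coeff, Pi.smul_apply, smul_eq_mul, mul_assoc, integral_const_mul,
          RingHom.id_apply] }
    1 fun f => by simpa using norm_coeff_le f κ

@[simp] lemma coeffL_apply (κ : ℕ →₀ ℤ) (f : L1) : coeffL κ f = coeff f κ := rfl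

lemma isClosed_H1 : IsClosed (H1 : Set L1) := by
  have : (H1 : Set L1) = ⋂ (κ : ℕ →₀ ℤ) (_ : ¬ ∀ j, 0 ≤ κ j), {f | coeffL κ f = 0} := by
    ext f
    simp only [Set.mem_iInter, Set.mem_ofPred_eq, coeffL_apply]
    rfl
  rw [this]
  exact isClosed_iInter fun κ => isClosed_iInter fun _ =>
    isClosed_eq (coeffL κ).continuous continuous_const

/-! ### The Abschnitt as a contraction of `L¹` -/

lemma eq_abschnitt {d : ℕ} {f g : L1} (h : ∀ κ, SuppBelow d κ → coeff g κ = coeff f κ)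
    (h0 : ∀ κ, ¬ SuppBelow d κ → coeff g κ = 0) : g = abschnitt d f :=
  (existsUnique_abschnitt d f).unique ⟨h, h0⟩ (abschnitt_spec d f)

lemma abschnitt_sub (d : ℕ) (f g : L1) :
    abschnitt d (f - g) = abschnitt d f - abschnitt d g := by
  symm
  refine eq_abschnitt (fun κ hκ => ?_) fun κ hκ => ?_
  · simp only [← coeffL_apply, map_sub]
    simp only [coeffL_apply, (abschnitt_spec d _).1 κ hκ]
  · simp only [← coeffL_apply, map_sub]
    simp only [coeffL_apply, (abschnitt_spec d _).2 κ hκ, sub_zero]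

lemma abschnitt_abschnitt {d e : ℕ} (h : d ≤ e) (f : L1) :
    abschnitt d (abschnitt e f) = abschnitt d f := by
  refine eq_abschnitt (fun κ hκ => ?_) fun κ hκ => (abschnitt_spec d _).2 κ hκ
  rw [(abschnitt_spec d _).1 κ hκ,
    (abschnitt_spec e _).1 κ fun j hj => hκ j (h.trans hj)]

/-- The Abschnitt averages over all coordinates beyond the first `d`. -/
lemma abschnitt_ae_eq (d : ℕ) (f : L1) :
    abschnitt d f =ᵐ[m] fun χ => ∫ η, f (glue d (χ, η)) ∂m := by
  classical
  have hF : Integrable (fun χ => ∫ η, f (glue d (χ, η)) ∂m) m :=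
    ((measurePreserving_glue d).integrable_comp_of_integrable (integrable_L1 f)).integral_prod_left
  have h : hF.toL1 _ = abschnitt d f := by
    refine eq_abschnitt (fun κ hκ => ?_) fun κ hκ => ?_
    · rw [coeff_congr hF.coeFn_toL1, coeff_average (integrable_L1 f), if_pos hκ]
    · rw [coeff_congr hF.coeFn_toL1, coeff_average (integrable_L1 f), if_neg hκ]
  rw [← h]
  exact hF.coeFn_toL1

lemma norm_abschnitt_le (d : ℕ) (f : L1) : ‖abschnitt d f‖ ≤ ‖f‖ := by
  have hg := measurePreserving_glue d
  have hi := (hg.integrable_comp_of_integrable (integrable_L1 f)).norm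
  have h1 := integral_map (μ := m.prod m) hg.measurable.aemeasurable
    (f := fun χ => ‖f χ‖) (by rw [hg.map_eq]; exact (integrable_L1 f).norm.1)
  rw [hg.map_eq] at h1
  rw [L1.norm_eq_integral_norm, L1.norm_eq_integral_norm, h1]
  have h2 := integral_prod _ hi
  simp only [Function.comp_def] at h2
  have h3 : ∫ χ, ‖abschnitt d f χ‖ ∂m = ∫ χ, ‖∫ η, f (glue d (χ, η)) ∂m‖ ∂m :=
    integral_congr_ae ((abschnitt_ae_eq d f).fun_comp norm)
  rw [h2, h3]
  refine integral_mono_of_nonneg (Eventually.of_forall fun _ => norm_nonneg _)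
    hi.integral_prod_left (Eventually.of_forall fun χ => ?_)
  exact norm_integral_le_integral_norm _

lemma continuous_abschnitt (d : ℕ) : Continuous (abschnitt d) :=
  (LipschitzWith.of_dist_le_mul (K := 1) fun f g => by
    rw [dist_eq_norm, dist_eq_norm, ← abschnitt_sub, NNReal.coe_one, one_mul]
    exact norm_abschnitt_le d _).continuous

/-! ### Density of the analytic trigonometric polynomials in `H¹` -/

instance : m.IsMulLeftInvariant := ⟨fun s => (measurePreserving_mul s).map_eq⟩

/-- The character `χ^κ` as an element of `L¹`. -/
def charL (κ : ℕ →₀ ℤ) : L1 := (integrable_of_continuous (continuous_char κ)).toL1 _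

lemma coeFn_charL (κ : ℕ →₀ ℤ) : charL κ =ᵐ[m] char κ := Integrable.coeFn_toL1 _

lemma exists_char_ne_one {κ : ℕ →₀ ℤ} (hκ : κ ≠ 0) : ∃ s, char κ s ≠ 1 := by
  obtain ⟨j, hne⟩ := Finsupp.ne_iff.1 hκ
  have hne : κ j ≠ 0 := hne
  -- at this point the character takes the value `-1`
  refine ⟨Pi.mulSingle j (Circle.exp (Real.pi / κ j)), ?_⟩
  have : κ.prod (fun i n => (Pi.mulSingle j (Circle.exp (Real.pi / κ j)) : Torus) i ^ n)
      = (Pi.mulSingle j (Circle.exp (Real.pi / κ j)) : Torus) j ^ κ j := by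
    refine Finsupp.prod_eq_single j (fun i _ hij => ?_) (by simp)
    simp [Pi.mulSingle_eq_of_ne hij]
  have hne' : (κ j : ℝ) ≠ 0 := by exact_mod_cast hne
  rw [char, circleChar, this, Pi.mulSingle_eq_same, ← Circle.exp_zsmul, zsmul_eq_mul,
    mul_div_cancel₀ _ hne']
  simp
  norm_num

lemma integral_char {κ : ℕ →₀ ℤ} (hκ : κ ≠ 0) : ∫ χ, char κ χ ∂m = 0 := by
  obtain ⟨s, hs⟩ := exists_char_ne_one hκ
  have h := integral_mul_left_eq_self (μ := m) (char κ) s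
  simp only [char_mul, integral_const_mul] at h
  by_contra hne
  exact hs (mul_right_cancel₀ hne (h.trans (one_mul _).symm))

lemma coeff_char (κ l : ℕ →₀ ℤ) : coeff (char κ) l = if κ = l then 1 else 0 := by
  have : coeff (char κ) l = ∫ χ, char (κ - l) χ ∂m := by
    simp only [coeff, sub_eq_add_neg, char_add, char_neg]
  rw [this]
  split_ifs with h
  · simp [h, char_zero]
  · exact integral_char (sub_ne_zero.2 h)

lemma coeff_charL (κ l : ℕ →₀ ℤ) : coeff (charL κ) l = if κ = l then 1 else 0 := by
  rw [coeff_congr (coeFn_charL κ), coeff_char]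

instance : Fact ((1 : ENNReal) ≠ ⊤) := ⟨ENNReal.one_ne_top⟩

/-- The translate `χ ↦ f (s χ)` of `f ∈ L¹`. -/
def translate (s : Torus) (f : L1) : L1 := DomMulAct.mk s • f

lemma translate_one (f : L1) : translate 1 f = f := by simp [translate]

lemma continuous_translate (f : L1) : Continuous fun s => translate s f :=
  have : ContinuousSMul Torusᵈᵐᵃ L1 :=
    Lp.instContinuousSMulDomMulAct (M := Torus) (X := Torus) (E := ℂ) (p := 1) (μ := m)
  DomMulAct.continuous_mk.smul continuous_const

lemma coeff_translate (s : Torus) (f : L1) (κ : ℕ →₀ ℤ) :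
    coeff (translate s f) κ = char κ s * coeff f κ := by
  have hae : translate s f =ᵐ[m] fun χ => f (s * χ) := DomMulAct.smul_Lp_ae_eq _ f
  rw [coeff_congr hae]
  have h := integral_mul_left_eq_self (μ := m) (fun χ => f χ * star (char κ χ)) s
  unfold coeff
  rw [← h, ← integral_const_mul]
  refine integral_congr_ae (Eventually.of_forall fun χ => ?_)
  have h1 : char κ s * star (char κ s) = 1 := by
    rw [← char_neg, ← char_add, add_neg_cancel, char_zero]
  simp only [char_mul, star_mul']
  linear_combination (-f (s * χ) * star (char κ χ)) * h1

/-- The vector-valued Fourier coefficients of the orbit map `s ↦ translate s f` are the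
homogeneous components of `f`. -/
lemma integral_translate (f : L1) (κ : ℕ →₀ ℤ) :
    ∫ s, star (char κ s) • translate s f ∂m = coeff f κ • charL κ := by
  have hc : Continuous fun s => star (char κ s) • translate s f :=
    (continuous_char κ).star.smul (continuous_translate f)
  refine L1_ext fun l => ?_
  rw [← coeffL_apply, ← coeffL_apply, ← (coeffL l).integral_comp_comm (integrable_of_continuous hc),
    map_smul]
  simp only [map_smul, coeffL_apply, coeff_translate, coeff_charL, smul_eq_mul]
  have := coeff_char l κ
  unfold coeff at this
  calc ∫ s, star (char κ s) * (char l s * coeff f l) ∂m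
      = (∫ s, char l s * star (char κ s) ∂m) * coeff f l := by
        rw [← integral_mul_const]
        congr 1; ext s; ring
    _ = _ := by
        rw [this]
        rcases eq_or_ne κ l with rfl | h
        · simp
        · simp [h, h.symm]

lemma exists_dual_of_notMem_closure {E : Type*} [NormedAddCommGroup E] [NormedSpace ℂ E]
    (S : Submodule ℂ E) {x : E} (hx : x ∉ S.topologicalClosure) :
    ∃ Λ : E →L[ℂ] ℂ, (∀ y ∈ S, Λ y = 0) ∧ Λ x ≠ 0 := by
  obtain ⟨Λ, u, h1, h2⟩ := RCLike.geometric_hahn_banach_closed_point (𝕜 := ℂ)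
    (s := (S.topologicalClosure : Set E)) (x := x)
    (S.topologicalClosure.restrictScalars ℝ).convex S.isClosed_topologicalClosure hx
  refine ⟨Λ, fun y hy => ?_, fun h0 => ?_⟩
  · by_contra hne
    -- the multiple of `y` at which `Λ` takes the value `u`
    have := h1 (((u : ℂ) / Λ y) • y) (Submodule.smul_mem _ _ (S.le_topologicalClosure hy))
    rw [map_smul, smul_eq_mul, div_mul_cancel₀ _ hne] at this
    simp at this
  · have := h1 0 (Submodule.zero_mem _)
    rw [h0] at h2
    simp at this h2
    linarith

/-- The analytic trigonometric polynomials: the span in `L¹` of the characters `χ^κ` with `κ`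
nonnegative. -/
def analyticPoly : Submodule ℂ L1 := Submodule.span ℂ (charL '' {κ | ∀ j, 0 ≤ κ j})

/-- If a functional `Λ` annihilates the analytic polynomials, then for `f ∈ H¹` the continuous
function `s ↦ Λ (translate s f)` has vanishing Fourier coefficients, so it vanishes at `s = 1`.
The Hahn–Banach theorem turns this into density. -/
lemma H1_le_closure_analyticPoly : H1 ≤ analyticPoly.topologicalClosure := by
  intro f hf
  by_contra hcon
  obtain ⟨Λ, h0, hne⟩ := exists_dual_of_notMem_closure analyticPoly hcon
  have hcont : Continuous fun s => Λ (translate s f) := Λ.continuous.comp (continuous_translate f)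
  have hF : (fun s => Λ (translate s f)) =ᵐ[m] 0 := by
    refine ae_eq_zero_of_coeff (integrable_of_continuous hcont) fun κ => ?_
    have h1 := Λ.integral_comp_comm (φ := fun s => star (char κ s) • translate s f)
      (integrable_of_continuous ((continuous_char κ).star.smul (continuous_translate f)))
    rw [integral_translate] at h1
    simp only [map_smul, smul_eq_mul] at h1
    unfold coeff
    simp_rw [mul_comm (Λ _)]
    rw [h1]
    by_cases hκ : ∀ j, 0 ≤ κ j
    · rw [h0 _ (Submodule.subset_span ⟨κ, hκ, rfl⟩), mul_zero]
    · rw [hf κ hκ, zero_mul]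
  have := congrFun (hcont.ae_eq_iff_eq m continuous_zero |>.1 hF) 1
  simp only [translate_one] at this
  exact hne this

/-! ### The Abschnitt of an analytic trigonometric polynomial -/

/-- The point whose first `d` coordinates are `1` and whose other coordinates are `z`. -/
def diagBeyond (d : ℕ) (z : Circle) : Torus := fun j => if j < d then 1 else z

lemma continuous_diagBeyond (d : ℕ) : Continuous (diagBeyond d) := by
  refine continuous_pi fun j => ?_
  by_cases hj : j < d <;> simp only [diagBeyond, hj, if_true, if_false] <;> fun_prop

/-- The degree of `χ^κ`, for nonnegative `κ`, in the coordinates beyond the first `d`. -/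
def degBeyond (d : ℕ) (κ : ℕ →₀ ℤ) : ℕ := ∑ j ∈ κ.support with ¬ j < d, (κ j).toNat

lemma char_diagBeyond (d : ℕ) {κ : ℕ →₀ ℤ} (hκ : ∀ j, 0 ≤ κ j) (z : Circle) :
    char κ (diagBeyond d z) = (z : ℂ) ^ degBeyond d κ := by
  rw [char, ← Circle.coe_pow]
  congr 1
  rw [circleChar, Finsupp.prod, degBeyond, ← Finset.prod_pow_eq_pow_sum, Finset.prod_filter]
  refine Finset.prod_congr rfl fun j _ => ?_
  by_cases hj : j < d
  · simp only [diagBeyond, hj, if_true, not_true_eq_false, if_false, one_zpow]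
    rfl
  · simp only [diagBeyond, hj, if_false, not_false_eq_true, if_true]
    conv_lhs => rw [← Int.toNat_of_nonneg (hκ j)]
    exact zpow_natCast z (κ j).toNat

lemma degBeyond_eq_zero_iff {d : ℕ} {κ : ℕ →₀ ℤ} (hκ : ∀ j, 0 ≤ κ j) :
    degBeyond d κ = 0 ↔ SuppBelow d κ := by
  simp only [degBeyond, Finset.sum_eq_zero_iff, Finset.mem_filter, Finsupp.mem_support_iff,
    SuppBelow, not_lt]
  constructor
  · intro h j hj
    by_contra hne
    have := h j ⟨hne, hj⟩
    have := hκ j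
    omega
  · rintro h j ⟨hne, hj⟩
    exact absurd (h j hj) hne

/-- The average of `F` over the rotations of all coordinates beyond the first `d` by a common
angle is a continuous function. -/
lemma continuous_circleAverage_diagBeyond (d : ℕ) {F : Torus → ℝ} (hF : Continuous F) :
    Continuous fun χ =>
      (2 * Real.pi)⁻¹ • ∫ θ in 0..2 * Real.pi, F (diagBeyond d (Circle.exp θ) * χ) := by
  have h2 : Continuous fun x : Torus × ℝ => diagBeyond d (Circle.exp x.2) :=
    (continuous_diagBeyond d).comp (Circle.exp.continuous.comp continuous_snd)
  have h3 : Continuous fun χ => ∫ θ in 0..2 * Real.pi, F (diagBeyond d (Circle.exp θ) * χ) :=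
    intervalIntegral.continuous_parametric_intervalIntegral_of_continuous' (μ := volume)
      (f := fun χ θ => F (diagBeyond d (Circle.exp θ) * χ)) (hF.comp (h2.mul continuous_fst)) _ _
  exact h3.const_smul (2 * Real.pi)⁻¹

lemma integral_circleAverage_diagBeyond (d : ℕ) {F : Torus → ℝ} (hF : Continuous F) :
    ∫ χ, ((2 * Real.pi)⁻¹ • ∫ θ in 0..2 * Real.pi, F (diagBeyond d (Circle.exp θ) * χ)) ∂m
      = ∫ χ, F χ ∂m := by
  rw [integral_smul, ← intervalIntegral_integral_swap]
  · simp only [integral_mul_left_eq_self]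
    rw [intervalIntegral.integral_const, smul_smul, sub_zero, inv_mul_cancel₀ (by positivity),
      one_smul]
  · have : IsFiniteMeasure (volume.restrict (Set.uIoc 0 (2 * Real.pi))) :=
      ⟨by simp [Set.uIoc_of_le Real.two_pi_pos.le, ENNReal.mul_lt_top]⟩
    obtain ⟨C, hC⟩ := hF.bounded_above_of_compact_support (.of_compactSpace F)
    have h2 : Continuous fun x : ℝ × Torus => diagBeyond d (Circle.exp x.1) * x.2 :=
      ((continuous_diagBeyond d).comp (Circle.exp.continuous.comp continuous_fst)).mul
        continuous_snd
    exact Integrable.of_bound (hF.comp h2).aestronglyMeasurable C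
      (Eventually.of_forall fun x => hC _)

/-- For an analytic trigonometric polynomial, the one-variable estimate
`circleAverage_norm_eval_sub_le`, applied to its restriction to each orbit of the common rotation
of the coordinates beyond the first `d`, is integrated over the torus; the value of that
restriction at the origin is the Abschnitt. -/
lemma integral_norm_sub_le_of_trigPoly (d : ℕ) (s : Finset (ℕ →₀ ℤ)) (hs : ∀ κ ∈ s, ∀ j, 0 ≤ κ j)
    (c : (ℕ →₀ ℤ) → ℂ) [DecidablePred (SuppBelow d)] {ε : ℝ} (hε : 0 < ε) (hε1 : ε ≤ 1) :
    ∫ χ, ‖∑ κ ∈ s, c κ * char κ χ - ∑ κ ∈ s with SuppBelow d κ, c κ * char κ χ‖ ∂m ≤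
      3 * ε * ∫ χ, ‖∑ κ ∈ s, c κ * char κ χ‖ ∂m +
        (∫ χ, ‖∑ κ ∈ s, c κ * char κ χ‖ ∂m -
          ∫ χ, ‖∑ κ ∈ s with SuppBelow d κ, c κ * char κ χ‖ ∂m) / ε := by
  set P : Torus → ℂ := fun χ => ∑ κ ∈ s, c κ * char κ χ with hP
  set Q : Torus → ℂ := fun χ => ∑ κ ∈ s with SuppBelow d κ, c κ * char κ χ with hQ
  have hPc : Continuous P := continuous_finsetSum _ fun κ _ =>
    continuous_const.mul (continuous_char κ)
  have hQc : Continuous Q := continuous_finsetSum _ fun κ _ =>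
    continuous_const.mul (continuous_char κ)
  -- the one-variable polynomial obtained by rotating all coordinates beyond the first `d` at once
  let R : Torus → Polynomial ℂ := fun χ =>
    ∑ κ ∈ s, Polynomial.C (c κ * char κ χ) * Polynomial.X ^ degBeyond d κ
  have hR : ∀ χ θ, (R χ).eval (circleMap 0 1 θ) = P (diagBeyond d (Circle.exp θ) * χ) := by
    intro χ θ
    simp only [R, hP, Polynomial.eval_finsetSum, Polynomial.eval_mul, Polynomial.eval_C,
      Polynomial.eval_pow, Polynomial.eval_X]
    refine Finset.sum_congr rfl fun κ hκ => ?_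
    rw [char_mul, char_diagBeyond d (hs κ hκ), Circle.coe_exp, circleMap_zero,
      Complex.ofReal_one, one_mul]
    ring
  have hR0 : ∀ χ, (R χ).eval 0 = Q χ := by
    intro χ
    simp only [R, hQ, Polynomial.eval_finsetSum, Polynomial.eval_mul, Polynomial.eval_C,
      Polynomial.eval_pow, Polynomial.eval_X, Finset.sum_filter]
    refine Finset.sum_congr rfl fun κ hκ => ?_
    simp [zero_pow_eq, degBeyond_eq_zero_iff (hs κ hκ)]
  have hQinv : ∀ θ χ, Q (diagBeyond d (Circle.exp θ) * χ) = Q χ := by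
    intro θ χ
    refine Finset.sum_congr rfl fun κ hκ => ?_
    rw [Finset.mem_filter] at hκ
    rw [char_mul, char_diagBeyond d (hs κ hκ.1), (degBeyond_eq_zero_iff (hs κ hκ.1)).2 hκ.2,
      pow_zero, one_mul]
  have key : ∀ χ,
      (2 * Real.pi)⁻¹ • ∫ θ in 0..2 * Real.pi, ‖P (diagBeyond d (Circle.exp θ) * χ) -
        Q (diagBeyond d (Circle.exp θ) * χ)‖ ≤
      (3 * ε + 1 / ε) * ((2 * Real.pi)⁻¹ • ∫ θ in 0..2 * Real.pi,
        ‖P (diagBeyond d (Circle.exp θ) * χ)‖) - 1 / ε * ‖Q χ‖ := by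
    intro χ
    have h := circleAverage_norm_eval_sub_le (R χ) hε hε1
    simp only [Real.circleAverage_def, hR, hR0] at h
    simp only [hQinv]
    exact h.trans_eq (by ring)
  have hPn := hPc.norm
  have hPi := (integrable_of_continuous
    (continuous_circleAverage_diagBeyond d hPn)).const_mul (3 * ε + 1 / ε)
  have hQi := (integrable_of_continuous hQc.norm).const_mul (1 / ε)
  have hfin := integral_mono (μ := m) (integrable_of_continuous
    (continuous_circleAverage_diagBeyond d (hPc.sub hQc).norm)) (hPi.sub hQi) key
  rw [integral_circleAverage_diagBeyond d (hPc.sub hQc).norm] at hfin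
  refine hfin.trans_eq ?_
  simp only [Pi.sub_apply]
  rw [integral_sub hPi hQi, integral_const_mul, integral_const_mul,
    integral_circleAverage_diagBeyond d hPn]
  ring

lemma exists_trigPoly_of_mem_analyticPoly {p : L1} (hp : p ∈ analyticPoly) :
    ∃ (s : Finset (ℕ →₀ ℤ)) (c : (ℕ →₀ ℤ) → ℂ), (∀ κ ∈ s, ∀ j, 0 ≤ κ j) ∧
      p = ∑ κ ∈ s, c κ • charL κ := by
  obtain ⟨l, hl, rfl⟩ := (Finsupp.mem_span_image_iff_linearCombination ℂ).1 hp
  exact ⟨l.support, l, fun κ hκ => (Finsupp.mem_supported ℂ l).1 hl hκ, rfl⟩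

lemma coeFn_sum_charL (s : Finset (ℕ →₀ ℤ)) (c : (ℕ →₀ ℤ) → ℂ) :
    (∑ κ ∈ s, c κ • charL κ : L1) =ᵐ[m] fun χ => ∑ κ ∈ s, c κ * char κ χ := by
  classical
  induction s using Finset.induction_on with
  | empty =>
    simp only [Finset.sum_empty]
    exact Lp.coeFn_zero ℂ 1 m
  | insert κ s hκ ih =>
    rw [Finset.sum_insert hκ]
    filter_upwards [Lp.coeFn_add (c κ • charL κ) (∑ κ ∈ s, c κ • charL κ), ih,
      Lp.coeFn_smul (c κ) (charL κ), coeFn_charL κ] with χ h1 h2 h3 h4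
    rw [h1, Pi.add_apply, h2, h3, Pi.smul_apply, h4, Finset.sum_insert hκ, smul_eq_mul]

lemma abschnitt_sum_charL (d : ℕ) (s : Finset (ℕ →₀ ℤ)) (c : (ℕ →₀ ℤ) → ℂ)
    [DecidablePred (SuppBelow d)] :
    abschnitt d (∑ κ ∈ s, c κ • charL κ) = ∑ κ ∈ s with SuppBelow d κ, c κ • charL κ := by
  have hco : ∀ (t : Finset (ℕ →₀ ℤ)) (l : ℕ →₀ ℤ),
      coeff ((∑ κ ∈ t, c κ • charL κ : L1) : Torus → ℂ) l = if l ∈ t then c l else 0 := by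
    intro t l
    rw [← coeffL_apply, map_sum]
    simp [coeff_charL]
  symm
  refine eq_abschnitt (fun l hl => ?_) fun l hl => ?_
  · rw [hco, hco]
    simp [hl]
  · rw [hco]
    simp [hl]

lemma norm_eq_integral_of_ae {f : L1} {g : Torus → ℂ} (h : f =ᵐ[m] g) : ‖f‖ = ∫ χ, ‖g χ‖ ∂m := by
  rw [L1.norm_eq_integral_norm]
  exact integral_congr_ae (h.fun_comp norm)

/-- For `f ∈ H¹`, an Abschnitt whose norm is close to that of `f` is close to `f`. For general
`f ∈ L¹` this fails; it is what replaces uniform integrability of the sequence of Abschnitte. -/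
lemma norm_sub_abschnitt_le (d : ℕ) {f : L1} (hf : f ∈ H1) {ε : ℝ} (hε : 0 < ε) (hε1 : ε ≤ 1) :
    ‖f - abschnitt d f‖ ≤ 3 * ε * ‖f‖ + (‖f‖ - ‖abschnitt d f‖) / ε := by
  classical
  have hA := continuous_abschnitt d
  have hcl : IsClosed {f : L1 | ‖f - abschnitt d f‖ ≤
      3 * ε * ‖f‖ + (‖f‖ - ‖abschnitt d f‖) / ε} :=
    isClosed_le (by fun_prop) (by fun_prop)
  refine closure_minimal (s := (analyticPoly : Set L1)) (fun p hp => ?_) hcl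
    (H1_le_closure_analyticPoly hf)
  obtain ⟨s, c, hs, rfl⟩ := exists_trigPoly_of_mem_analyticPoly hp
  have h := integral_norm_sub_le_of_trigPoly d s hs c hε hε1
  have h1 := coeFn_sum_charL s c
  have h2 := coeFn_sum_charL (s.filter (SuppBelow d)) c
  have h3 : (∑ κ ∈ s, c κ • charL κ - ∑ κ ∈ s with SuppBelow d κ, c κ • charL κ : L1) =ᵐ[m]
      fun χ => ∑ κ ∈ s, c κ * char κ χ - ∑ κ ∈ s with SuppBelow d κ, c κ * char κ χ :=
    (Lp.coeFn_sub _ _).trans (h1.sub h2)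
  rw [Set.mem_ofPred_eq, abschnitt_sum_charL, norm_eq_integral_of_ae h1,
    norm_eq_integral_of_ae h2, norm_eq_integral_of_ae h3]
  exact h

/-! ### Convergence of the Abschnitte and the chain property -/

lemma exists_abschnitt_eq_self {p : L1} (hp : p ∈ analyticPoly) :
    ∃ N, ∀ d, N ≤ d → abschnitt d p = p := by
  classical
  obtain ⟨s, c, -, rfl⟩ := exists_trigPoly_of_mem_analyticPoly hp
  refine ⟨(s.biUnion Finsupp.support).sup id + 1, fun d hd => ?_⟩
  rw [abschnitt_sum_charL, Finset.filter_true_of_mem]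
  intro κ hκ j hj
  by_contra hne
  have := Finset.le_sup (f := id) (Finset.mem_biUnion.2 ⟨κ, hκ, Finsupp.mem_support_iff.2 hne⟩)
  simp only [id] at this
  omega

lemma tendsto_norm_sub_abschnitt {f : L1} (hf : f ∈ H1) :
    Tendsto (fun d : ℕ => ‖f - abschnitt d f‖) atTop (𝓝 0) := by
  rw [Metric.tendsto_atTop]
  intro ε hε
  obtain ⟨p, hp, hfp⟩ := Metric.mem_closure_iff.1 (H1_le_closure_analyticPoly hf) (ε / 2)
    (half_pos hε)
  obtain ⟨N, hN⟩ := exists_abschnitt_eq_self hp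
  refine ⟨N, fun d hd => ?_⟩
  have h1 : f - abschnitt d f = (f - p) - abschnitt d (f - p) := by
    rw [abschnitt_sub, hN d hd]; abel
  have h2 := norm_sub_le (f - p) (abschnitt d (f - p))
  have h3 := norm_abschnitt_le d (f - p)
  rw [dist_eq_norm] at hfp
  rw [dist_zero_right, norm_norm, h1]
  linarith

lemma abschnitt_eq_of_chain {f : ℕ → L1} (hchain : ∀ d, 1 ≤ d → abschnitt d (f (d + 1)) = f d)
    {d e : ℕ} (hd : 1 ≤ d) (hde : d ≤ e) : abschnitt d (f e) = f d := by
  induction e, hde using Nat.le_induction with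
  | base => rw [← hchain d hd, abschnitt_abschnitt le_rfl]
  | succ e hde ih => rw [← ih, ← hchain e (hd.trans hde), abschnitt_abschnitt hde]

/-- The norms `‖f d‖` increase to a finite limit, so `norm_sub_abschnitt_le` forces the sequence
to be Cauchy: the term `3 * ε * ‖f‖` is made small first, then the increment of the norms. -/
lemma cauchySeq_of_chain {f : ℕ → L1} (hf : ∀ d, 1 ≤ d → f d ∈ H1) {C : ℝ}
    (hC : ∀ d, 1 ≤ d → ‖f d‖ ≤ C) (hchain : ∀ d, 1 ≤ d → abschnitt d (f (d + 1)) = f d) :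
    CauchySeq f := by
  have hC0 : 0 ≤ C := (norm_nonneg _).trans (hC 1 le_rfl)
  have hmono : Monotone fun n => ‖f (n + 1)‖ := monotone_nat_of_le_succ fun n => by
    rw [← hchain (n + 1) (by omega)]
    exact norm_abschnitt_le _ _
  have hbdd : BddAbove (Set.range fun n => ‖f (n + 1)‖) :=
    ⟨C, by rintro _ ⟨n, rfl⟩; exact hC _ (by omega)⟩
  have hcau := (tendsto_atTop_ciSup hmono hbdd).cauchySeq
  rw [← cauchySeq_shift 1, Metric.cauchySeq_iff']
  intro δ hδ
  obtain ⟨ε, hε, hε1, hεδ⟩ : ∃ ε : ℝ, 0 < ε ∧ ε ≤ 1 ∧ 3 * ε * C ≤ δ / 2 := by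
    refine ⟨min 1 (δ / (6 * (C + 1))), by positivity, min_le_left _ _, ?_⟩
    calc 3 * min 1 (δ / (6 * (C + 1))) * C ≤ 3 * (δ / (6 * (C + 1))) * (C + 1) := by
          gcongr
          · exact min_le_right _ _
          · linarith
      _ = δ / 2 := by field_simp; ring
  obtain ⟨N, hN⟩ := Metric.cauchySeq_iff'.1 hcau (ε * (δ / 2)) (by positivity)
  refine ⟨N, fun n hn => ?_⟩
  have h1 := norm_sub_abschnitt_le (N + 1) (hf (n + 1) (by omega)) hε hε1
  rw [abschnitt_eq_of_chain hchain (by omega) (by omega)] at h1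
  have h2 := (le_abs_self _).trans_lt (hN n hn)
  have h3 : 3 * ε * ‖f (n + 1)‖ ≤ 3 * ε * C := by gcongr; exact hC _ (by omega)
  have h4 : (‖f (n + 1)‖ - ‖f (N + 1)‖) / ε < δ / 2 := by
    rw [div_lt_iff₀ hε, mul_comm]; exact h2
  rw [dist_eq_norm]
  linarith

lemma exists_of_chain {f : ℕ → L1} (hf : ∀ d, 1 ≤ d → f d ∈ H1) {C : ℝ}
    (hC : ∀ d, 1 ≤ d → ‖f d‖ ≤ C) (hchain : ∀ d, 1 ≤ d → abschnitt d (f (d + 1)) = f d) :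
    ∃ g ∈ H1, ∀ d, 1 ≤ d → f d = abschnitt d g := by
  obtain ⟨g, hg⟩ := cauchySeq_tendsto_of_complete (cauchySeq_of_chain hf hC hchain)
  refine ⟨g, isClosed_H1.mem_of_tendsto hg ((eventually_ge_atTop 1).mono hf), fun d hd => ?_⟩
  refine tendsto_nhds_unique (tendsto_const_nhds.congr' ?_)
    (((continuous_abschnitt d).tendsto g).comp hg)
  filter_upwards [eventually_ge_atTop d] with e he
  exact (abschnitt_eq_of_chain hchain hd he).symm

end InfTorus

end

theorem mainTheorem4 :
    (∀ f ∈ InfTorus.H1,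
      Tendsto (fun d : ℕ => ‖f - InfTorus.abschnitt d f‖) atTop (𝓝 0)) ∧
    (∀ f : ℕ → InfTorus.L1,
      (∀ d, 1 ≤ d → f d ∈ InfTorus.H1) →
      (∃ C : ℝ, ∀ d, 1 ≤ d → ‖f d‖ ≤ C) →
      (∀ d, 1 ≤ d → InfTorus.abschnitt d (f (d + 1)) = f d) →
      ∃ g ∈ InfTorus.H1, ∀ d, 1 ≤ d → f d = InfTorus.abschnitt d g) :=
  ⟨fun _ hf => InfTorus.tendsto_norm_sub_abschnitt hf,
    fun _ hf ⟨_, hC⟩ hchain => InfTorus.exists_of_chain hf hC hchain⟩
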